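/- For $0<\sigma\le\pi$ and $s\in\mathbb{C}$ with $\Re(s)>1$, let $$\mathrm{SLs}(s;\sigma)=\frac{1}{\Gamma(s-1)}\int_0^\sigma(\theta-\sigma)\left(-2\log\frac{\sin(\theta/2)}{\sin(\sigma/2)}\right)^{s-2}\mathrm{d}\theta .$$ Define polynomials $p_n,q_n\in\mathbb{Z}[x]$ for integers $n\ge-1$ by $p_{-1}=0$, $q_{-1}=1$ and $$p_{n+1}(x)=2(nx+1)p_n(x)+2x(1-x)p_n'(x)+q_n(x),$$ $$q_{n+1}(x)=(2(n+1)x+1)q_n(x)+2x(1-x)q_n'(x).$$ For $k\in\mathbb{Z}$, define the poly-Bernoulli numbers $B_n^{(k)}\in\mathbb{Q}$ ($n\ge0$) by $$\sum_{n=0}^\infty B_n^{(k)}\frac{x^n}{n!}=\frac{\mathrm{Li}_k(1-e^{-x})}{1-e^{-x}},\qquad \mathrm{Li}_k(z)=\sum_{m=1}^\infty\frac{z^m}{m^k}.$$ Theorem. Let $0<\sigma<\pi$. The integral defining $\mathrm{SLs}(s;\sigma)$ converges absolutely for $\Re(s)>1$, and $\mathrm{SLs}(\,\cdot\,;\sigma)$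 has a unique analytic continuation from the half-plane $\Re(s)>1$ to an entire function on $\mathbb{C}$, again denoted by $\mathrm{SLs}(s;\sigma)$. For every integer $n\ge-1$, $$\mathrm{SLs}(-n;\sigma)=\frac{x\,p_n(x)}{2^n(1-x)^{n+1}},\qquad x=\sin^2(\sigma/2).$$ In particular, for every integer $n\ge0$, $$\mathrm{SLs}(-n;\pi/3)=\frac13\sum_{k=0}^n B_{n-k}^{(-k)}.$$ -/

import Mathlib

noncomputable section

/-- The integrand `(θ - σ) (-2 log (sin (θ/2) / sin (σ/2)))^(s-2)` of the shifted log-sine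
integral. For `0 < θ < σ ≤ π` the base of the complex power is a positive real number. -/
def shiftedLogSineIntegrand (s : ℂ) (σ θ : ℝ) : ℂ :=
  ((θ - σ : ℝ) : ℂ) *
    ((-2 * Real.log (Real.sin (θ / 2) / Real.sin (σ / 2)) : ℝ) : ℂ) ^ (s - 2)

/-- The shifted log-sine integral `SLs(s; σ)` in its domain of definition `0 < σ ≤ π`, `Re s > 1`:
`Γ(s-1)⁻¹ ∫_0^σ (θ - σ) (-2 log (sin (θ/2) / sin (σ/2)))^(s-2) dθ`. -/
def shiftedLogSine (s : ℂ) (σ : ℝ) : ℂ :=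
  1 / Complex.Gamma (s - 1) * ∫ θ in (0 : ℝ)..σ, shiftedLogSineIntegrand s σ θ

/-- `F` is an analytic continuation of `SLs(·; σ)` from the half-plane `Re s > 1` to all of `ℂ`. -/
def IsShiftedLogSineContinuation (σ : ℝ) (F : ℂ → ℂ) : Prop :=
  Differentiable ℂ F ∧ ∀ s : ℂ, 1 < s.re → F s = shiftedLogSine s σ

/-- The pairs of Lehmer polynomials `(p_n, q_n)`, `n ≥ -1`, indexed by `m = n + 1`:
`p_{-1} = 0`, `q_{-1} = 1`,
`p_{n+1} = 2 (n x + 1) p_n + 2 x (1 - x) p_n' + q_n`,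
`q_{n+1} = (2 (n + 1) x + 1) q_n + 2 x (1 - x) q_n'`. -/
def lehmerPair : ℕ → Polynomial ℤ × Polynomial ℤ
  | 0 => (0, 1)
  | m + 1 =>
    let p := (lehmerPair m).1
    let q := (lehmerPair m).2
    (2 * (Polynomial.C ((m : ℤ) - 1) * Polynomial.X + 1) * p
        + 2 * Polynomial.X * (1 - Polynomial.X) * Polynomial.derivative p + q,
      (2 * Polynomial.C (m : ℤ) * Polynomial.X + 1) * q
        + 2 * Polynomial.X * (1 - Polynomial.X) * Polynomial.derivative q)

/-- The Lehmer polynomial `p_n` for an integer `n ≥ -1` (for `n < -1` the value is `0` and has no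
meaning). -/
def lehmerP (n : ℤ) : Polynomial ℤ := (lehmerPair (n + 1).toNat).1

/-- The formal power series `Li_k(z) / z = ∑_{m ≥ 1} z^(m-1) / m^k`, for an integer `k`. -/
def polylogDivX (k : ℤ) : PowerSeries ℚ :=
  PowerSeries.mk fun m : ℕ => 1 / ((m : ℚ) + 1) ^ k

/-- The formal power series `1 - e^(-x)`. -/
def oneSubExpNeg : PowerSeries ℚ :=
  1 - PowerSeries.evalNegHom (PowerSeries.exp ℚ)

/-- The poly-Bernoulli number `B_n^{(k)}`, for an integer `k`, defined by
`∑_n B_n^{(k)} x^n / n! = Li_k(1 - e^(-x)) / (1 - e^(-x))`. -/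
def polyBernoulli (k : ℤ) (n : ℕ) : ℚ :=
  (n.factorial : ℚ) * PowerSeries.coeff n ((polylogDivX k).subst oneSubExpNeg)

end

/-! Substituting `t = -2 log (sin (θ/2) / sin (σ/2))` gives `dθ/dt = -tan (θ/2)` and turns SLs(s; σ)
into `Γ(s-1)⁻¹` times the Mellin transform at `s - 1` of `f(t) = (θ - σ) tan (θ/2)`. Since `f` and
its derivatives decay exponentially, repeated integration by parts continues this to an entire
function whose value at `s - 1 = -m` is `(-d/dt)^m f` at `t = 0`. The Lehmer recursion is exactly
the rule for these derivatives (`hasDerivAt_logSineDeriv`); at `t = 0`, `θ = σ` removes the `q`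
term.

For `σ = π/3`, `f` solves `(4 - e^(-t)) f' + 2 f + e^(-t) = 0`. Let `L` be the functional sending
`X^m` to `(-d/dt)^m f (0)`. The equation becomes `L((4X - 2) p - X p(X+1)) = p(1)`, which together
with `L(1) = 0` determines `L`, because the leading coefficient is `4 - 1 = 3`. On the other side
`B_n^(-k) = ∑_j a(k,j) a(n,j)` with `a(n,j) = j! S(n+1,j+1)`, so the poly-Bernoulli sum is `∑_j
M_j(X^(n+1))` for functionals `M_j` built from the self-convolution of `a(·,j)`. A shift identity
(`stirlingFunctional_shift`) makes the relation for `∑_j M_j` telescope to `3 p(1)`, hence `3 L =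
∑_j M_j`. -/

/-! ### Poly-Bernoulli numbers of negative index and Stirling numbers -/

/-- The number `j! * S(n+1, j+1)` entering the explicit formula for poly-Bernoulli numbers of
negative index, where `S` is the Stirling number of the second kind. -/
def factorialStirling (n j : ℕ) : ℕ := j.factorial * Nat.stirlingSecond (n + 1) (j + 1)

theorem factorialStirling_succ_zero (n : ℕ) :
    factorialStirling (n + 1) 0 = factorialStirling n 0 := by
  simp [factorialStirling, Nat.stirlingSecond_succ_succ]

theorem factorialStirling_zero_right (n : ℕ) : factorialStirling n 0 = 1 := by
  induction n with
  | zero => simp [factorialStirling, Nat.stirlingSecond_self]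
  | succ n ih => rw [factorialStirling_succ_zero, ih]

theorem factorialStirling_succ_succ (n j : ℕ) :
    factorialStirling (n + 1) (j + 1) =
      (j + 2) * factorialStirling n (j + 1) + (j + 1) * factorialStirling n j := by
  simp only [factorialStirling]
  rw [Nat.stirlingSecond_succ_succ (n + 1) (j + 1), Nat.factorial_succ]
  ring

theorem factorialStirling_eq_zero_of_lt {n j : ℕ} (h : n < j) : factorialStirling n j = 0 := by
  simp [factorialStirling, Nat.stirlingSecond_eq_zero_of_lt (Nat.add_lt_add_right h 1)]

/-- A sum over `j < J` of terms obeying the recursion of `factorialStirling`, at `n + 1`. -/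
theorem sum_factorialStirling_succ {R : Type*} [CommSemiring R] (n J : ℕ) (hJ : n < J)
    (u : ℕ → R) :
    ∑ j ∈ Finset.range (J + 1), (factorialStirling (n + 1) j : R) * u j =
      ∑ j ∈ Finset.range J, (factorialStirling n j : R) * ((j + 1) * u j + (j + 1) * u (j + 1)) := by
  have h1 : ∑ j ∈ Finset.range J, (factorialStirling n j : R) * ((j + 1) * u j) =
      ∑ j ∈ Finset.range (J + 1), (factorialStirling n j : R) * ((j + 1) * u j) := by
    rw [Finset.sum_range_succ, factorialStirling_eq_zero_of_lt hJ]; simp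
  simp only [mul_add (factorialStirling n _ : R)]
  rw [Finset.sum_add_distrib, h1, Finset.sum_range_succ', Finset.sum_range_succ' _ J,
    factorialStirling_succ_zero]
  simp only [factorialStirling_succ_succ]
  push_cast
  rw [add_right_comm, ← Finset.sum_add_distrib]
  congr 1
  · exact Finset.sum_congr rfl fun j _ => by ring
  · ring

section

open PowerSeries

/-- Here `mk 1` is `1/(1-z)`. Differentiating `(z/(1-z))^(j+1)` produces only the terms of index `j`
and `j + 1`, with the weights of the recursion for `factorialStirling`. -/
theorem polylogDivX_eq_sum (k : ℕ) {J : ℕ} (hJ : k < J) :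
    polylogDivX (-(k : ℤ)) = ∑ j ∈ Finset.range J,
      (factorialStirling k j : ℚ⟦X⟧) * (X ^ j * (mk 1 : ℚ⟦X⟧) ^ (j + 1)) := by
  have hg : (mk 1 : ℚ⟦X⟧) * (1 - X) = 1 := mk_one_mul_one_sub_eq_one ℚ
  have hd : d⁄dX ℚ (mk 1 : ℚ⟦X⟧) = (mk 1 : ℚ⟦X⟧) ^ 2 := by
    have h := congrArg (fun f => (mk 1 : ℚ⟦X⟧) * d⁄dX ℚ f) hg
    simp only [Derivation.leibniz, map_sub, Derivation.map_one_eq_zero, derivative_X,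
      smul_eq_mul] at h
    linear_combination h - (d⁄dX ℚ (mk 1 : ℚ⟦X⟧)) * hg
  induction k generalizing J with
  | zero =>
    rw [Finset.sum_eq_single_of_mem 0 (by simpa using hJ)]
    · ext n; simp [polylogDivX, factorialStirling_zero_right]
    · intro j _ hj
      rw [factorialStirling_eq_zero_of_lt (Nat.pos_of_ne_zero hj)]; simp
  | succ k ih =>
    obtain ⟨J, rfl⟩ : ∃ K, J = K + 1 := ⟨J - 1, by omega⟩
    -- `Li_{-k-1} = z · d/dz Li_{-k}`, divided by `z`.
    have hs : polylogDivX (-((k + 1 : ℕ) : ℤ)) = d⁄dX ℚ (X * polylogDivX (-(k : ℤ))) := by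
      ext n
      rw [coeff_derivative, coeff_succ_X_mul]
      simp only [polylogDivX, coeff_mk, zpow_neg, zpow_natCast, one_div, inv_inv]
      ring
    rw [hs, ih (show k < J by omega), sum_factorialStirling_succ k J (by omega), Finset.mul_sum,
      map_sum]
    refine Finset.sum_congr rfl fun j _ => ?_
    have e : (X : ℚ⟦X⟧) * ((factorialStirling k j : ℚ⟦X⟧) * (X ^ j * (mk 1 : ℚ⟦X⟧) ^ (j + 1))) =
      (factorialStirling k j) • ((X ^ (j + 1) * (mk 1 : ℚ⟦X⟧) ^ (j + 1))) := by
        rw [nsmul_eq_mul]; ring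
    rw [e, map_nsmul, nsmul_eq_mul, Derivation.leibniz, Derivation.leibniz_pow,
      Derivation.leibniz_pow, hd, derivative_X]
    simp only [smul_eq_mul, nsmul_eq_mul, Nat.add_sub_cancel]
    push_cast
    ring

theorem oneSubExpNeg_hasSubst : HasSubst oneSubExpNeg := by
  apply HasSubst.of_constantCoeff_zero'
  rw [oneSubExpNeg, map_sub, ← coeff_zero_eq_constantCoeff_apply (evalNegHom _), evalNegHom,
    coeff_rescale]
  simp

theorem subst_oneSubExpNeg_mk_one : (mk 1 : ℚ⟦X⟧).subst oneSubExpNeg = exp ℚ := by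
  have h := congrArg (fun f : ℚ⟦X⟧ => exp ℚ * f.subst oneSubExpNeg)
    (mk_one_mul_one_sub_eq_one ℚ)
  have h1 : (1 : ℚ⟦X⟧).subst oneSubExpNeg = 1 := by
    rw [← coe_substAlgHom oneSubExpNeg_hasSubst, map_one]
  simp only [subst_mul oneSubExpNeg_hasSubst, subst_sub oneSubExpNeg_hasSubst,
    subst_X oneSubExpNeg_hasSubst, h1] at h
  have he : exp ℚ * evalNegHom (exp ℚ) = 1 := exp_mul_exp_neg_eq_one
  rw [oneSubExpNeg] at h ⊢
  linear_combination h - (mk 1 : ℚ⟦X⟧).subst (1 - evalNegHom (exp ℚ)) * he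

/-- For `z = 1 - e^(-x)`, `1/(1-z) = e^x` and `z/(1-z) = e^x - 1`. -/
theorem subst_polylogDivX (k : ℕ) {J : ℕ} (hJ : k < J) :
    (polylogDivX (-(k : ℤ))).subst oneSubExpNeg = ∑ j ∈ Finset.range J,
      (factorialStirling k j : ℚ⟦X⟧) * (exp ℚ * (exp ℚ - 1) ^ j) := by
  rw [polylogDivX_eq_sum k hJ, ← coe_substAlgHom oneSubExpNeg_hasSubst, map_sum]
  refine Finset.sum_congr rfl fun j _ => ?_
  simp only [map_mul, map_natCast, map_pow]
  rw [coe_substAlgHom, subst_X oneSubExpNeg_hasSubst, subst_oneSubExpNeg_mk_one]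
  have he : exp ℚ * evalNegHom (exp ℚ) = 1 := exp_mul_exp_neg_eq_one
  have : exp ℚ - 1 = oneSubExpNeg * exp ℚ := by
    rw [oneSubExpNeg]; linear_combination he
  rw [this]
  ring

theorem coeff_exp_mul_exp_sub_one_pow (n j : ℕ) :
    (n.factorial : ℚ) * coeff n (exp ℚ * (exp ℚ - 1) ^ j) = factorialStirling n j := by
  induction n generalizing j with
  | zero =>
    rcases j with _ | j
    · simp [factorialStirling_zero_right]
    · simp [factorialStirling_eq_zero_of_lt]
  | succ n ih =>
    have h (f : ℚ⟦X⟧) : ((n + 1).factorial : ℚ) * coeff (n + 1) f =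
        n.factorial * coeff n (d⁄dX ℚ f) := by
      rw [coeff_derivative, Nat.factorial_succ]; push_cast; ring
    rw [h]
    rcases j with _ | j
    · rw [factorialStirling_succ_zero, ← ih]
      simp [derivative_exp]
    · have hd : d⁄dX ℚ (exp ℚ * (exp ℚ - 1) ^ (j + 1)) =
          ((j + 2 : ℕ) : ℚ) • (exp ℚ * (exp ℚ - 1) ^ (j + 1)) +
            ((j + 1 : ℕ) : ℚ) • (exp ℚ * (exp ℚ - 1) ^ j) := by
        rw [Derivation.leibniz, Derivation.leibniz_pow, map_sub, Derivation.map_one_eq_zero,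
          derivative_exp, Nat.cast_smul_eq_nsmul, Nat.cast_smul_eq_nsmul]
        simp only [smul_eq_mul, nsmul_eq_mul, Nat.add_sub_cancel]
        push_cast
        ring
      rw [hd, map_add, coeff_smul, coeff_smul, factorialStirling_succ_succ]
      push_cast
      rw [← ih, ← ih]
      ring

/-- Poly-Bernoulli numbers of negative index in terms of Stirling numbers. -/
theorem polyBernoulli_neg (k n : ℕ) {J : ℕ} (hJ : k < J) :
    polyBernoulli (-(k : ℤ)) n =
      ∑ j ∈ Finset.range J, (factorialStirling k j : ℚ) * factorialStirling n j := by
  rw [polyBernoulli, subst_polylogDivX k hJ, map_sum, Finset.mul_sum]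
  refine Finset.sum_congr rfl fun j _ => ?_
  rw [← coeff_exp_mul_exp_sub_one_pow n j, ← nsmul_eq_mul (factorialStirling k j), map_nsmul,
    nsmul_eq_mul]
  ring

end

/-! ### Moment functionals of Stirling convolutions and their shift identity -/

section

open Polynomial

/-- The linear functional on polynomials sending `X ^ n` to `u n`. -/
def momentFunctional (u : ℕ → ℝ) : ℝ[X] →ₗ[ℝ] ℝ :=
  lsum fun n => LinearMap.toSpanSingleton ℝ ℝ (u n)

theorem momentFunctional_X_pow (u : ℕ → ℝ) (n : ℕ) : momentFunctional u (X ^ n) = u n := by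
  rw [← monomial_one_right_eq_X_pow, momentFunctional, lsum_apply, sum_monomial_index] <;> simp

theorem momentFunctional_one (u : ℕ → ℝ) : momentFunctional u 1 = u 0 := by
  simpa using momentFunctional_X_pow u 0

theorem momentFunctional_X (u : ℕ → ℝ) : momentFunctional u X = u 1 := by
  simpa using momentFunctional_X_pow u 1

theorem momentFunctional_C_mul (u : ℕ → ℝ) (c : ℝ) (p : ℝ[X]) :
    momentFunctional u (C c * p) = c * momentFunctional u p := by
  rw [← smul_eq_C_mul, map_smul, smul_eq_mul]

/-- Linear maps on polynomials agree if they agree on powers of `X`. -/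
theorem linearMap_ext_X_pow {f g : ℝ[X] →ₗ[ℝ] ℝ} (h : ∀ n, f (X ^ n) = g (X ^ n)) (p : ℝ[X]) :
    f p = g p := by
  have : f = g := by
    refine lhom_ext' fun n => LinearMap.ext_ring ?_
    simpa [monomial_one_right_eq_X_pow] using h n
  rw [this]

/-- The convolution `∑ₖ a(k,j) a(n-k,j)` of `a = factorialStirling`. -/
def stirlingConv (j n : ℕ) : ℝ :=
  ∑ k ∈ Finset.range (n + 1), (factorialStirling k j : ℝ) * factorialStirling (n - k) j

/-- The ordinary generating function of `factorialStirling · j`. -/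
def stirlingSeries (j : ℕ) : PowerSeries ℝ := PowerSeries.mk fun n => (factorialStirling n j : ℝ)

theorem coeff_stirlingSeries_sq (j n : ℕ) :
    PowerSeries.coeff n (stirlingSeries j ^ 2) = stirlingConv j n := by
  rw [sq, PowerSeries.coeff_mul, Finset.Nat.sum_antidiagonal_eq_sum_range_succ_mk]
  simp [stirlingSeries, stirlingConv]

theorem stirlingSeries_succ (j : ℕ) :
    (1 - PowerSeries.C ((j : ℝ) + 2) * PowerSeries.X) * stirlingSeries (j + 1) =
      PowerSeries.C ((j : ℝ) + 1) * PowerSeries.X * stirlingSeries j := by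
  ext n
  rw [sub_mul, one_mul, map_sub, mul_assoc, mul_assoc, PowerSeries.coeff_C_mul,
    PowerSeries.coeff_C_mul]
  rcases n with _ | n
  · simp [stirlingSeries, factorialStirling_eq_zero_of_lt]
  · rw [PowerSeries.coeff_succ_X_mul, PowerSeries.coeff_succ_X_mul]
    simp only [stirlingSeries, PowerSeries.coeff_mk, factorialStirling_succ_succ]
    push_cast
    ring

theorem stirlingConv_eq_zero {j n : ℕ} (h : n < j) : stirlingConv j n = 0 := by
  refine Finset.sum_eq_zero fun k hk => ?_
  rw [factorialStirling_eq_zero_of_lt (show k < j by simp at hk; omega)]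
  simp

theorem stirlingConv_zero_left (n : ℕ) : stirlingConv 0 n = n + 1 := by
  simp [stirlingConv, factorialStirling_zero_right]

/-- Coefficients of the square of `stirlingSeries_succ`. -/
theorem stirlingConv_succ (j n : ℕ) :
    stirlingConv (j + 1) (n + 2) - 2 * (j + 2) * stirlingConv (j + 1) (n + 1) +
      (j + 2) ^ 2 * stirlingConv (j + 1) n = (j + 1) ^ 2 * stirlingConv j n := by
  have h : stirlingSeries (j + 1) ^ 2 -
      PowerSeries.X * (PowerSeries.C (2 * ((j : ℝ) + 2)) * stirlingSeries (j + 1) ^ 2) +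
      PowerSeries.X * (PowerSeries.X * (PowerSeries.C (((j : ℝ) + 2) ^ 2) *
        stirlingSeries (j + 1) ^ 2)) =
      PowerSeries.X * (PowerSeries.X * (PowerSeries.C (((j : ℝ) + 1) ^ 2) *
        stirlingSeries j ^ 2)) := by
    have := congrArg (· ^ 2) (stirlingSeries_succ j)
    simp only [map_mul, map_pow, show PowerSeries.C (2 : ℝ) = 2 from map_ofNat _ 2]
    linear_combination this
  have := congrArg (PowerSeries.coeff (n + 2)) h
  simpa only [map_add, map_sub, PowerSeries.coeff_succ_X_mul, PowerSeries.coeff_C_mul,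
    coeff_stirlingSeries_sq] using this

/-- The functional with moments `0, stirlingConv j 0, stirlingConv j 1, …`. -/
def stirlingFunctional (j : ℕ) : ℝ[X] →ₗ[ℝ] ℝ :=
  momentFunctional fun n => n.casesOn 0 (stirlingConv j)

theorem stirlingFunctional_X_pow_succ (j n : ℕ) :
    stirlingFunctional j (X ^ (n + 1)) = stirlingConv j n := momentFunctional_X_pow _ _

theorem stirlingFunctional_one (j : ℕ) : stirlingFunctional j 1 = 0 := momentFunctional_one _

theorem stirlingFunctional_C_mul (j : ℕ) (c : ℝ) (p : ℝ[X]) :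
    stirlingFunctional j (C c * p) = c * stirlingFunctional j p := momentFunctional_C_mul _ _ _

theorem stirlingFunctional_zero (p : ℝ[X]) :
    stirlingFunctional 0 p = (derivative p).eval 1 := by
  refine linearMap_ext_X_pow (g := (leval 1).comp derivative) (fun n => ?_) p
  rcases n with _ | n
  · simp [stirlingFunctional_one]
  · rw [stirlingFunctional_X_pow_succ, stirlingConv_zero_left]
    simp

theorem stirlingFunctional_X (j : ℕ) : stirlingFunctional (j + 1) X = 0 := by
  have := stirlingFunctional_X_pow_succ (j + 1) 0
  rw [stirlingConv_eq_zero (Nat.succ_pos _)] at this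
  simpa using this

theorem stirlingFunctional_X_sq (j : ℕ) :
    stirlingFunctional (j + 1) (X ^ 2) = 0 := by
  rw [stirlingFunctional_X_pow_succ]
  rcases j with _ | j
  · simp [stirlingConv, Finset.sum_range_succ, factorialStirling_eq_zero_of_lt]
  · exact stirlingConv_eq_zero (by omega)

/-- The recurrence `stirlingConv_succ` in umbral form. For `n = 0` the recurrence does not apply,
but all moments involved are zero. -/
theorem stirlingFunctional_succ_sq_mul (j : ℕ) (p : ℝ[X]) :
    stirlingFunctional (j + 1) ((X - C ((j : ℝ) + 2)) ^ 2 * p) =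
      (j + 1) ^ 2 * stirlingFunctional j p := by
  refine linearMap_ext_X_pow
    (f := (stirlingFunctional (j + 1)).comp (LinearMap.mulLeft ℝ ((X - C ((j : ℝ) + 2)) ^ 2)))
    (g := ((j : ℝ) + 1) ^ 2 • stirlingFunctional j) (fun n => ?_) p
  have e : (X - C ((j : ℝ) + 2)) ^ 2 * X ^ n =
      X ^ (n + 2) - C (2 * ((j : ℝ) + 2)) * X ^ (n + 1) + C (((j : ℝ) + 2) ^ 2) * X ^ n := by
    simp only [map_mul, map_pow, map_ofNat]
    ring
  simp only [LinearMap.comp_apply, LinearMap.mulLeft_apply, LinearMap.smul_apply, smul_eq_mul]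
  rw [e, map_add, map_sub, stirlingFunctional_C_mul, stirlingFunctional_C_mul]
  rcases n with _ | n
  · simp only [pow_zero, stirlingFunctional_one, zero_add, pow_one, stirlingFunctional_X,
      stirlingFunctional_X_sq]
    ring
  · simp only [stirlingFunctional_X_pow_succ]
    exact stirlingConv_succ j n

/-- Only moments of degree at most 2 occur. They vanish except for `M_0(X) = 1` and `M_0(X^2) = 2`.
-/
theorem stirlingFunctional_shift_linear (j : ℕ) (a b : ℝ) :
    stirlingFunctional j (X * (C a * X + C b).comp (X + 1)) =
    stirlingFunctional j ((X + C (2 * (j : ℝ) + 1)) * (C a * X + C b)) -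
      stirlingFunctional (j + 1) ((C (2 * (j : ℝ) + 5) - C 3 * X) * (C a * X + C b)) := by
  have e1 : (X : ℝ[X]) * (C a * X + C b).comp (X + 1) = C a * X ^ 2 + C (a + b) * X := by
    simp; ring
  have e2 : (X + C (2 * (j : ℝ) + 1)) * (C a * X + C b) =
      C a * X ^ 2 + C ((2 * j + 1) * a + b) * X + C ((2 * j + 1) * b) * 1 := by
    simp; ring
  have e3 : (C (2 * (j : ℝ) + 5) - C 3 * X) * (C a * X + C b) =
      C (-3 * a) * X ^ 2 + C ((2 * j + 5) * a - 3 * b) * X + C ((2 * j + 5) * b) * 1 := by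
    simp only [map_add, map_sub, map_mul, map_neg, map_ofNat, map_natCast]; ring
  rw [e1, e2, e3]
  simp only [map_add (stirlingFunctional _), stirlingFunctional_C_mul, stirlingFunctional_X,
    stirlingFunctional_X_sq, stirlingFunctional_one]
  rcases j with _ | j
  · have h1 : stirlingFunctional 0 X = 1 := by simp [stirlingFunctional_zero]
    have h2 : stirlingFunctional 0 (X ^ 2) = 2 := by
      simp [stirlingFunctional_zero, one_add_one_eq_two]
    rw [h1, h2]
    push_cast
    ring
  · rw [stirlingFunctional_X, stirlingFunctional_X_sq]
    ring

/-- Divide `p` by `(X - (j+2))^2`: the linear remainder is settled by direct computation. On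
multiples, the shift turns the divisor into `(X - (j+1))^2` and `M_{j+1}` drops to `M_j`, which
leaves the hypothesis `h`. -/
theorem stirlingFunctional_shift_of_sq_mul (j : ℕ) (p : ℝ[X]) (h : ∀ q : ℝ[X],
    stirlingFunctional j ((X - C ((j : ℝ) + 1)) ^ 2 * (X * q.comp (X + 1))) =
    stirlingFunctional j ((X + C (2 * (j : ℝ) + 1)) * ((X - C ((j : ℝ) + 2)) ^ 2 * q)) -
      (j + 1) ^ 2 * stirlingFunctional j ((C (2 * (j : ℝ) + 5) - C 3 * X) * q)) :
    stirlingFunctional j (X * p.comp (X + 1)) =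
    stirlingFunctional j ((X + C (2 * (j : ℝ) + 1)) * p) -
      stirlingFunctional (j + 1) ((C (2 * (j : ℝ) + 5) - C 3 * X) * p) := by
  have hm : ((X - C ((j : ℝ) + 2)) ^ 2).Monic := (monic_X_sub_C _).pow 2
  have hdeg : (p %ₘ (X - C ((j : ℝ) + 2)) ^ 2).natDegree ≤ 1 := by
    have := natDegree_modByMonic_lt p hm fun h1 => by
      have := congrArg natDegree h1
      rw [natDegree_pow, natDegree_X_sub_C, natDegree_one] at this
      omega
    simp only [natDegree_pow, natDegree_X_sub_C] at this
    omega
  obtain ⟨a, b, hab⟩ := exists_eq_X_add_C_of_natDegree_le_one hdeg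
  have hp := modByMonic_add_div p ((X - C ((j : ℝ) + 2)) ^ 2)
  rw [hab] at hp
  generalize p /ₘ (X - C ((j : ℝ) + 2)) ^ 2 = q at hp
  have e1 : X * ((X - C ((j : ℝ) + 2)) ^ 2 * q).comp (X + 1) =
      (X - C ((j : ℝ) + 1)) ^ 2 * (X * q.comp (X + 1)) := by
    rw [mul_comp, pow_comp, sub_comp, X_comp, C_comp]
    simp only [map_add, map_one, map_ofNat]
    ring
  have e2 : (C (2 * (j : ℝ) + 5) - C 3 * X) * ((X - C ((j : ℝ) + 2)) ^ 2 * q) =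
      (X - C ((j : ℝ) + 2)) ^ 2 * ((C (2 * (j : ℝ) + 5) - C 3 * X) * q) := by ring
  have h1 := stirlingFunctional_shift_linear j a b
  have h2 := h q
  rw [← e1, ← stirlingFunctional_succ_sq_mul, ← e2] at h2
  rw [← hp, add_comp, mul_add X, mul_add _ (C a * X + C b), mul_add _ (C a * X + C b),
    map_add (stirlingFunctional _), map_add (stirlingFunctional _), map_add (stirlingFunctional _),
    h1, h2]
  ring

/-- Behaviour of `stirlingFunctional` under the shift `X ↦ X + 1`. -/
theorem stirlingFunctional_shift (j : ℕ) (p : ℝ[X]) :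
    stirlingFunctional j (X * p.comp (X + 1)) =
      stirlingFunctional j ((X + C (2 * (j : ℝ) + 1)) * p) -
        stirlingFunctional (j + 1) ((C (2 * (j : ℝ) + 5) - C 3 * X) * p) := by
  induction j generalizing p with
  | zero =>
    refine stirlingFunctional_shift_of_sq_mul _ _ fun q => ?_
    -- Both sides are zero: `(X+1)(X-2)^2 - (5-3X) = (X-1)^3`, so each side is the derivative at 1
    -- of a multiple of `(X-1)^2`.
    simp only [stirlingFunctional_zero, derivative_mul, derivative_pow,
      derivative_add, derivative_sub, derivative_C, derivative_X]
    simp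
    ring
  | succ j ih =>
    refine stirlingFunctional_shift_of_sq_mul _ _ fun q => ?_
    have e : ((j + 1 : ℕ) : ℝ) + 1 = j + 2 := by push_cast; ring
    -- Drop to `M_j`, apply `ih`, and raise back to `M_{j+1}`. What remains is the identity
    -- `(X-(j+2))^2 (X+2j+1) - (j+1)^2 (2j+5-3X) = (X+2j+3) (X-(j+3))^2 - (j+2)^2 (2j+7-3X)`.
    rw [e, stirlingFunctional_succ_sq_mul, ih, mul_sub, ← stirlingFunctional_succ_sq_mul,
      ← stirlingFunctional_C_mul, ← stirlingFunctional_C_mul, ← map_sub, ← map_sub]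
    congr 1
    push_cast
    simp only [map_add, map_mul, map_pow, map_ofNat, map_one, map_natCast]
    ring

/-- Telescoping, because `4X - 2 = (X + 2j + 1) - (2j + 3 - 3X)`. -/
theorem sum_stirlingFunctional_shift (J : ℕ) (p : ℝ[X]) :
    ∑ j ∈ Finset.range J, stirlingFunctional j ((C 4 * X - C 2) * p - X * p.comp (X + 1)) =
      3 * p.eval 1 + stirlingFunctional J ((C (2 * (J : ℝ) + 3) - C 3 * X) * p) := by
  induction J with
  | zero =>
    simp [stirlingFunctional_zero]
  | succ J ih =>
    rw [Finset.sum_range_succ, ih, map_sub, stirlingFunctional_shift]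
    have e1 : (C 4 * X - C 2) * p = (X + C (2 * (J : ℝ) + 1)) * p -
        (C (2 * (J : ℝ) + 3) - C 3 * X) * p := by
      simp only [map_add, map_mul, map_ofNat, map_one]
      ring
    have e2 : 2 * ((J + 1 : ℕ) : ℝ) + 3 = 2 * J + 5 := by push_cast; ring
    rw [e1, e2, map_sub]
    ring

/-- The moments of a functional `L` with `L((4X-2)p(X) - X p(X+1)) = p(1)` and `L(1) = 0`. -/
theorem three_mul_eq_sum_stirlingFunctional (L : ℝ[X] →ₗ[ℝ] ℝ) (h1 : L 1 = 0)
    (hL : ∀ p : ℝ[X], L ((C 4 * X - C 2) * p - X * p.comp (X + 1)) = p.eval 1)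
    (n J : ℕ) (hn : n ≤ J) :
    3 * L (X ^ n) = ∑ j ∈ Finset.range J, stirlingFunctional j (X ^ n) := by
  set D : ℝ[X] →ₗ[ℝ] ℝ := (3 : ℝ) • L - ∑ j ∈ Finset.range J, stirlingFunctional j with hD
  have hDa (p : ℝ[X]) :
      D p = 3 * L p - ∑ j ∈ Finset.range J, stirlingFunctional j p := by
    simp [hD, LinearMap.sum_apply]
  suffices D (X ^ n) = 0 by rw [hDa] at this; linarith
  induction n using Nat.strong_induction_on with
  | _ n ih =>
    rcases n with _ | n
    · simp [hDa, h1, stirlingFunctional_one]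
    -- The boundary term of the telescoped sum involves moments of `M_J` of degree at most `n + 1 ≤
    -- J`, all zero.
    · have hz : D ((C 4 * X - C 2) * X ^ n - X * (X ^ n : ℝ[X]).comp (X + 1)) = 0 := by
        rw [hDa, hL, sum_stirlingFunctional_shift]
        have e : (C (2 * (J : ℝ) + 3) - C 3 * X) * X ^ n =
            C (2 * (J : ℝ) + 3) * X ^ n - C 3 * X ^ (n + 1) := by ring
        rw [e, map_sub, stirlingFunctional_C_mul, stirlingFunctional_C_mul,
          stirlingFunctional_X_pow_succ, stirlingConv_eq_zero (by omega)]
        rcases n with _ | n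
        · simp [stirlingFunctional_one]
        · rw [stirlingFunctional_X_pow_succ, stirlingConv_eq_zero (by omega)]
          ring
      -- The coefficient 3 of `X^(n+1)` is nonzero, so lower moments determine the next one.
      have e : (C 4 * X - C 2) * X ^ n - X * (X ^ n : ℝ[X]).comp (X + 1) =
          (3 : ℝ) • X ^ (n + 1) - (2 : ℝ) • X ^ n -
            ∑ i ∈ Finset.range n, (n.choose i : ℝ) • X ^ (i + 1) := by
        rw [X_pow_comp, add_pow, Finset.sum_range_succ, mul_add, Finset.mul_sum]
        simp only [smul_eq_C_mul, map_natCast, map_ofNat, Nat.choose_self, one_pow, mul_one,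
          Nat.cast_one]
        have : ∑ i ∈ Finset.range n, (X : ℝ[X]) * (X ^ i * (n.choose i : ℝ[X])) =
            ∑ i ∈ Finset.range n, (n.choose i : ℝ[X]) * X ^ (i + 1) :=
          Finset.sum_congr rfl fun i _ => by ring
        rw [this]
        ring
      rw [e, map_sub, map_sub, map_smul, map_smul, map_sum, ih n (by omega) (by omega),
        Finset.sum_eq_zero fun i hi => ?_] at hz
      · simpa using hz
      · have := Finset.mem_range.1 hi
        rw [map_smul, ih (i + 1) (by omega) (by omega), smul_zero]

theorem sum_stirlingConv (n : ℕ) :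
    ∑ j ∈ Finset.range (n + 1), stirlingConv j n =
      ((∑ k ∈ Finset.range (n + 1), polyBernoulli (-(k : ℤ)) (n - k) : ℚ) : ℝ) := by
  simp only [stirlingConv]
  rw [Finset.sum_comm, Rat.cast_sum]
  refine Finset.sum_congr rfl fun k hk => ?_
  rw [polyBernoulli_neg k (n - k) (Finset.mem_range.1 hk)]
  push_cast
  rfl

end

/-! ### Entire continuation of normalized Mellin transforms -/

/-- A sequence of functions on `[0, ∞)`, each the negative of the derivative of the one before it,
all of which decay exponentially at rate `c`. -/
structure IsDecayingDerivSeq (c : ℝ) (h : ℕ → ℝ → ℝ) : Prop where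
  pos : 0 < c
  hasDerivAt : ∀ m t, 0 ≤ t → HasDerivAt (h m) (-h (m + 1) t) t
  bound : ∀ m, ∃ C, ∀ t, 0 ≤ t → |h m t| ≤ C * Real.exp (-c * t)

namespace IsDecayingDerivSeq

open Filter Topology MeasureTheory Set Asymptotics

variable {c : ℝ} {h : ℕ → ℝ → ℝ}

theorem hasDerivAt_ofReal (H : IsDecayingDerivSeq c h) (m : ℕ) {t : ℝ} (ht : 0 ≤ t) :
    HasDerivAt (fun t => (h m t : ℂ)) (-(h (m + 1) t : ℂ)) t := by
  simpa using (H.hasDerivAt m t ht).ofReal_comp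

theorem locallyIntegrableOn (H : IsDecayingDerivSeq c h) (m : ℕ) :
    LocallyIntegrableOn (fun t => (h m t : ℂ)) (Ioi 0) := by
  refine ContinuousOn.locallyIntegrableOn (fun t ht => ?_) measurableSet_Ioi
  exact (H.hasDerivAt_ofReal m (le_of_lt ht)).continuousAt.continuousWithinAt

theorem isBigO_exp (H : IsDecayingDerivSeq c h) (m : ℕ) :
    (fun t => (h m t : ℂ)) =O[atTop] fun t => Real.exp (-c * t) := by
  obtain ⟨C, hC⟩ := H.bound m
  refine IsBigO.of_bound C ?_
  filter_upwards [eventually_ge_atTop 0] with t ht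
  simpa [abs_of_pos (Real.exp_pos _)] using hC t ht

theorem isBigO_zero (H : IsDecayingDerivSeq c h) (m : ℕ) :
    (fun t => (h m t : ℂ)) =O[𝓝[>] 0] fun t : ℝ => t ^ (-(0 : ℝ)) := by
  simp only [neg_zero, Real.rpow_zero]
  exact ((H.hasDerivAt_ofReal m le_rfl).continuousAt.continuousWithinAt.tendsto).isBigO_one ℝ

theorem mellinConvergent (H : IsDecayingDerivSeq c h) (m : ℕ) {s : ℂ} (hs : 0 < s.re) :
    MellinConvergent (fun t => (h m t : ℂ)) s :=
  mellinConvergent_of_isBigO_rpow_exp H.pos (H.locallyIntegrableOn m) (H.isBigO_exp m)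
    (H.isBigO_zero m) hs

theorem differentiableAt_mellin (H : IsDecayingDerivSeq c h) (m : ℕ) {s : ℂ} (hs : 0 < s.re) :
    DifferentiableAt ℂ (mellin fun t => (h m t : ℂ)) s :=
  mellin_differentiableAt_of_isBigO_rpow_exp H.pos (H.locallyIntegrableOn m) (H.isBigO_exp m)
    (H.isBigO_zero m) hs

theorem tendsto_mul_cpow_atTop (H : IsDecayingDerivSeq c h) (m : ℕ) (s : ℂ) :
    Tendsto (fun t : ℝ => (h m t : ℂ) * (t : ℂ) ^ s) atTop (𝓝 0) := by
  obtain ⟨C, hC⟩ := H.bound m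
  have h1 := (tendsto_rpow_mul_exp_neg_mul_atTop_nhds_zero s.re c H.pos).const_mul C
  rw [mul_zero] at h1
  refine squeeze_zero_norm' ?_ h1
  filter_upwards [eventually_gt_atTop 0] with t ht
  rw [norm_mul, Complex.norm_cpow_eq_rpow_re_of_pos ht, Complex.norm_real, Real.norm_eq_abs]
  calc _ ≤ (C * Real.exp (-c * t)) * t ^ s.re := by gcongr; exact hC t ht.le
    _ = _ := by ring

theorem tendsto_mul_cpow_zero (H : IsDecayingDerivSeq c h) (m : ℕ) {s : ℂ} (hs : 0 < s.re) :
    Tendsto (fun t : ℝ => (h m t : ℂ) * (t : ℂ) ^ s) (𝓝[>] 0) (𝓝 0) := by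
  have h1 := (H.hasDerivAt_ofReal m le_rfl).continuousAt
  have h2 : ContinuousAt (fun t : ℝ => (t : ℂ) ^ s) 0 :=
    Complex.continuousAt_ofReal_cpow_const 0 s (Or.inl hs)
  have h3 := (h1.mul h2).tendsto
  have hs0 : s ≠ 0 := fun h0 => by simp [h0] at hs
  simp only [Pi.mul_apply, Complex.ofReal_zero, Complex.zero_cpow hs0, mul_zero] at h3
  exact h3.mono_left nhdsWithin_le_nhds

/-- Integration by parts; the boundary terms vanish by `0 < re s` at 0 and by exponential decay at
infinity. -/
theorem mellin_eq_mellin_succ_div (H : IsDecayingDerivSeq c h) (m : ℕ) {s : ℂ} (hs : 0 < s.re) :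
    mellin (fun t => (h m t : ℂ)) s = mellin (fun t => (h (m + 1) t : ℂ)) (s + 1) / s := by
  have hs0 : s ≠ 0 := fun h0 => by simp [h0] at hs
  have hv (t : ℝ) (ht : t ∈ Ioi (0 : ℝ)) :
      HasDerivAt (fun t : ℝ => (t : ℂ) ^ s / s) ((t : ℂ) ^ (s - 1)) t := by
    have := hasDerivAt_ofReal_cpow_const' (r := s - 1) (ne_of_gt ht)
      (fun h0 => hs0 (by linear_combination h0))
    simpa using this
  have hs1 : 0 < (s + 1).re := by simp; linarith
  have c1 := H.mellinConvergent m hs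
  have c2 := H.mellinConvergent (m + 1) hs1
  rw [MellinConvergent] at c1 c2
  simp only [smul_eq_mul, add_sub_cancel_right] at c1 c2
  have key := integral_Ioi_mul_deriv_eq_deriv_mul (a := (0 : ℝ)) (a' := (0 : ℂ)) (b' := (0 : ℂ))
    (u := fun t => (h m t : ℂ)) (u' := fun t => -(h (m + 1) t : ℂ))
    (fun t ht => H.hasDerivAt_ofReal m (le_of_lt ht)) hv
    (c1.congr_fun (fun t _ => by simp [mul_comm]) measurableSet_Ioi)
    (IntegrableOn.congr_fun (c2.div_const (-s)) (fun t _ => by simp; ring) measurableSet_Ioi)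
    (by simpa [Pi.mul_def, mul_div_assoc] using (H.tendsto_mul_cpow_zero m hs).div_const s)
    (by simpa [Pi.mul_def, mul_div_assoc] using (H.tendsto_mul_cpow_atTop m s).div_const s)
  simp only [mellin, smul_eq_mul, add_sub_cancel_right]
  rw [← integral_div]
  simp only [sub_self, zero_sub] at key
  rw [← integral_neg] at key
  refine Eq.trans ?_ (key.trans ?_)
  · exact integral_congr_ae (Eventually.of_forall fun t => mul_comm _ _)
  · exact integral_congr_ae (Eventually.of_forall fun t => by simp only; ring)

theorem mellin_succ_one (H : IsDecayingDerivSeq c h) (m : ℕ) :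
    mellin (fun t => (h (m + 1) t : ℂ)) 1 = h m 0 := by
  have c1 := H.mellinConvergent (m + 1) (s := 1) (by simp)
  rw [MellinConvergent] at c1
  simp only [smul_eq_mul, sub_self, Complex.cpow_zero, one_mul] at c1
  have lim : Tendsto (fun t => (h m t : ℂ)) atTop (𝓝 0) := by
    simpa using H.tendsto_mul_cpow_atTop m 0
  have key := integral_Ioi_of_hasDerivAt_of_tendsto'
    (fun t (ht : t ∈ Ici (0 : ℝ)) => H.hasDerivAt_ofReal m ht) c1.neg lim
  rw [integral_neg] at key
  simp only [mellin, smul_eq_mul, sub_self, Complex.cpow_zero, one_mul]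
  linear_combination -key

/-- The normalized Mellin transform of `h m` at `s + m`; it does not depend on `m` as long as
`0 < re (s + m)`. -/
noncomputable def shiftedMellin (h : ℕ → ℝ → ℝ) (m : ℕ) (s : ℂ) : ℂ :=
  (Complex.Gamma (s + m))⁻¹ * mellin (fun t => (h m t : ℂ)) (s + m)

theorem shiftedMellin_succ (H : IsDecayingDerivSeq c h) (m : ℕ) {s : ℂ} (hs : 0 < s.re + m) :
    shiftedMellin h (m + 1) s = shiftedMellin h m s := by
  have hs' : 0 < (s + m).re := by simpa using hs
  have hs0 : s + m ≠ 0 := fun h0 => by simp [h0] at hs'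
  simp only [shiftedMellin]
  rw [H.mellin_eq_mellin_succ_div m hs', Nat.cast_succ, ← add_assoc, Complex.Gamma_add_one _ hs0,
    mul_inv]
  ring

theorem shiftedMellin_eq (H : IsDecayingDerivSeq c h) {m n : ℕ} (hmn : m ≤ n) {s : ℂ}
    (hs : 0 < s.re + m) : shiftedMellin h n s = shiftedMellin h m s := by
  induction n, hmn using Nat.le_induction with
  | base => rfl
  | succ n hn ih =>
    have : (m : ℝ) ≤ n := by exact_mod_cast hn
    rw [H.shiftedMellin_succ n (by linarith), ih]

theorem differentiableAt_shiftedMellin (H : IsDecayingDerivSeq c h) (m : ℕ) {s : ℂ}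
    (hs : 0 < s.re + m) : DifferentiableAt ℂ (shiftedMellin h m) s := by
  have hs' : 0 < (s + m).re := by simpa using hs
  have hadd : DifferentiableAt ℂ (fun z : ℂ => z + m) s := by fun_prop
  exact ((Complex.differentiable_one_div_Gamma _).comp s hadd).mul
    (DifferentiableAt.comp (g := mellin fun t => (h m t : ℂ)) s (H.differentiableAt_mellin m hs')
      hadd)

/-- The entire continuation of the normalized Mellin transform of `h 0`. -/
noncomputable def entireMellin (h : ℕ → ℝ → ℝ) (s : ℂ) : ℂ := shiftedMellin h (⌊-s.re⌋₊ + 1) s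

theorem entireMellin_eq (H : IsDecayingDerivSeq c h) (m : ℕ) {s : ℂ} (hs : 0 < s.re + m) :
    entireMellin h s = shiftedMellin h m s := by
  have h1 : 0 < s.re + (⌊-s.re⌋₊ + 1 : ℕ) := by
    have := Nat.lt_floor_add_one (-s.re)
    push_cast
    linarith
  rcases le_total m (⌊-s.re⌋₊ + 1) with h2 | h2
  · exact H.shiftedMellin_eq h2 hs
  · exact (H.shiftedMellin_eq h2 h1).symm

theorem differentiable_entireMellin (H : IsDecayingDerivSeq c h) :
    Differentiable ℂ (entireMellin h) := by
  intro s
  obtain ⟨m, hm⟩ := exists_nat_gt (-s.re)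
  have hs : 0 < s.re + m := by linarith
  refine (H.differentiableAt_shiftedMellin m hs).congr_of_eventuallyEq ?_
  have : ∀ᶠ z : ℂ in 𝓝 s, 0 < z.re + m :=
    (Complex.continuous_re.add continuous_const).continuousAt.eventually_const_lt hs
  filter_upwards [this] with z hz using H.entireMellin_eq m hz

theorem entireMellin_eq_mellin (H : IsDecayingDerivSeq c h) {s : ℂ} (hs : 0 < s.re) :
    entireMellin h s = (Complex.Gamma s)⁻¹ * mellin (fun t => (h 0 t : ℂ)) s := by
  rw [H.entireMellin_eq 0 (by simpa using hs), shiftedMellin]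
  simp

/-- At level `m + 1` the Mellin argument is 1, where `Γ(1) = 1` and the integral of `-(h m)'` over
`(0, ∞)` is `h m 0`. -/
theorem entireMellin_neg_natCast (H : IsDecayingDerivSeq c h) (m : ℕ) :
    entireMellin h (-(m : ℂ)) = h m 0 := by
  rw [H.entireMellin_eq (m + 1) (by simp), shiftedMellin,
    show -(m : ℂ) + (m + 1 : ℕ) = 1 by push_cast; ring, H.mellin_succ_one]
  simp

end IsDecayingDerivSeq

/-! ### The log-sine substitution and Lehmer polynomials -/

/-- The angle `θ ∈ (0, σ]` with `-2 log (sin (θ/2) / sin (σ/2)) = t`. -/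
noncomputable def logSineAngle (σ t : ℝ) : ℝ :=
  2 * Real.arcsin (Real.sin (σ / 2) * Real.exp (-t / 2))

/-- The value `sin² (θ/2)` for `θ = logSineAngle σ t`. -/
noncomputable def logSineSq (σ t : ℝ) : ℝ := Real.sin (σ / 2) ^ 2 * Real.exp (-t)

/-- The function `(-d/dt)^m ((θ - σ) tan (θ/2))` for `θ = logSineAngle σ t`, in terms of the Lehmer
polynomials. -/
noncomputable def logSineDeriv (σ : ℝ) (m : ℕ) (t : ℝ) : ℝ :=
  (logSineAngle σ t - σ) * Real.tan (logSineAngle σ t / 2) *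
      Polynomial.aeval (logSineSq σ t) (lehmerPair m).2 * ((2 * (1 - logSineSq σ t))⁻¹) ^ m +
    2 * logSineSq σ t * Polynomial.aeval (logSineSq σ t) (lehmerPair m).1 *
      ((2 * (1 - logSineSq σ t))⁻¹) ^ m

section

open Real Set Filter Topology MeasureTheory

variable {σ t : ℝ}

theorem sin_half_pos (h0 : 0 < σ) (hπ : σ < π) : 0 < sin (σ / 2) :=
  sin_pos_of_pos_of_lt_pi (by linarith) (by linarith)

theorem sin_half_lt_one (h0 : 0 < σ) (hπ : σ < π) : sin (σ / 2) < 1 := by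
  rw [← sin_pi_div_two]
  exact sin_lt_sin_of_lt_of_le_pi_div_two (by linarith) le_rfl (by linarith)

theorem sin_half_mul_exp_le (h0 : 0 < σ) (hπ : σ < π) (ht : 0 ≤ t) :
    sin (σ / 2) * exp (-t / 2) ≤ sin (σ / 2) :=
  mul_le_of_le_one_right (sin_half_pos h0 hπ).le (exp_le_one_iff.2 (by linarith))

theorem sin_half_mul_exp_pos (h0 : 0 < σ) (hπ : σ < π) (t : ℝ) :
    0 < sin (σ / 2) * exp (-t / 2) := mul_pos (sin_half_pos h0 hπ) (exp_pos _)

theorem logSineSq_eq (σ t : ℝ) : logSineSq σ t = (sin (σ / 2) * exp (-t / 2)) ^ 2 := by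
  rw [logSineSq, mul_pow, ← exp_nat_mul]
  congr 2
  push_cast
  ring

theorem logSineSq_nonneg (σ t : ℝ) : 0 ≤ logSineSq σ t := by rw [logSineSq_eq]; positivity

theorem logSineSq_le (ht : 0 ≤ t) : logSineSq σ t ≤ sin (σ / 2) ^ 2 :=
  mul_le_of_le_one_right (sq_nonneg _) (exp_le_one_iff.2 (by linarith))

theorem sin_half_sq_lt_one (h0 : 0 < σ) (hπ : σ < π) : sin (σ / 2) ^ 2 < 1 :=
  pow_lt_one₀ (sin_half_pos h0 hπ).le (sin_half_lt_one h0 hπ) two_ne_zero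

theorem logSineSq_lt_one (h0 : 0 < σ) (hπ : σ < π) (ht : 0 ≤ t) : logSineSq σ t < 1 :=
  (logSineSq_le ht).trans_lt (sin_half_sq_lt_one h0 hπ)

theorem tan_logSineAngle (σ t : ℝ) : tan (logSineAngle σ t / 2) =
    sin (σ / 2) * exp (-t / 2) / √(1 - logSineSq σ t) := by
  rw [logSineAngle, mul_div_cancel_left₀ _ two_ne_zero, tan_arcsin, logSineSq_eq]

theorem tan_logSineAngle_sq (h0 : 0 < σ) (hπ : σ < π) (ht : 0 ≤ t) :
    tan (logSineAngle σ t / 2) ^ 2 = 2 * logSineSq σ t * (2 * (1 - logSineSq σ t))⁻¹ := by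
  have h := logSineSq_lt_one h0 hπ ht
  have h' : 1 - logSineSq σ t ≠ 0 := by linarith
  rw [tan_logSineAngle, div_pow, sq_sqrt (by linarith), ← logSineSq_eq]
  field_simp

theorem tan_logSineAngle_pos (h0 : 0 < σ) (hπ : σ < π) (ht : 0 ≤ t) :
    0 < tan (logSineAngle σ t / 2) := by
  rw [tan_logSineAngle]
  have h := logSineSq_lt_one h0 hπ ht
  exact div_pos (sin_half_mul_exp_pos h0 hπ t) (sqrt_pos.2 (by linarith))

theorem hasDerivAt_logSineAngle (h0 : 0 < σ) (hπ : σ < π) (ht : 0 ≤ t) :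
    HasDerivAt (logSineAngle σ) (-tan (logSineAngle σ t / 2)) t := by
  have hu : HasDerivAt (fun t : ℝ => sin (σ / 2) * exp (-t / 2))
      (sin (σ / 2) * (exp (-t / 2) * (-1 / 2))) t :=
    (((hasDerivAt_id t).neg.div_const 2).exp).const_mul _
  have h1 := sin_half_mul_exp_le h0 hπ ht
  have h2 := sin_half_mul_exp_pos h0 hπ t
  have h3 := sin_half_lt_one h0 hπ
  have := ((hasDerivAt_arcsin (by linarith) (by linarith)).comp t hu).const_mul 2
  refine this.congr_deriv ?_
  rw [tan_logSineAngle, logSineSq_eq]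
  ring

theorem hasDerivAt_tan_logSineAngle (h0 : 0 < σ) (hπ : σ < π) (ht : 0 ≤ t) :
    HasDerivAt (fun t => tan (logSineAngle σ t / 2))
      (-(tan (logSineAngle σ t / 2) * (2 * (1 - logSineSq σ t))⁻¹)) t := by
  have h := logSineSq_lt_one h0 hπ ht
  have hc : cos (logSineAngle σ t / 2) ^ 2 = 1 - logSineSq σ t := by
    rw [logSineAngle, mul_div_cancel_left₀ _ two_ne_zero, cos_arcsin, ← logSineSq_eq,
      sq_sqrt (by linarith)]
  have hc0 : cos (logSineAngle σ t / 2) ≠ 0 := fun h0 => by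
    rw [h0] at hc
    linarith
  have := (Real.hasDerivAt_tan hc0).comp t ((hasDerivAt_logSineAngle h0 hπ ht).div_const 2)
  refine this.congr_deriv ?_
  rw [hc]
  have h' : 1 - logSineSq σ t ≠ 0 := by linarith
  field_simp

theorem hasDerivAt_logSineSq (σ t : ℝ) : HasDerivAt (logSineSq σ) (-logSineSq σ t) t := by
  have : HasDerivAt (logSineSq σ) (sin (σ / 2) ^ 2 * (exp (-t) * (-1))) t :=
    (hasDerivAt_id t).neg.exp.const_mul _
  exact this.congr_deriv (by rw [logSineSq]; ring)

theorem hasDerivAt_inv_one_sub_logSineSq_pow (h0 : 0 < σ) (hπ : σ < π) (ht : 0 ≤ t) (m : ℕ) :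
    HasDerivAt (fun t => ((2 * (1 - logSineSq σ t))⁻¹) ^ m)
      (-(2 * m * logSineSq σ t * ((2 * (1 - logSineSq σ t))⁻¹) ^ (m + 1))) t := by
  have h := logSineSq_lt_one h0 hπ ht
  have h' : 2 * (1 - logSineSq σ t) ≠ 0 := by linarith
  have := ((((hasDerivAt_logSineSq σ t).const_sub 1).const_mul 2).inv h').pow m
  refine this.congr_deriv ?_
  rcases m with _ | m
  · simp
  · simp only [Pi.inv_apply, Nat.add_sub_cancel, div_eq_mul_inv, ← inv_pow]
    ring

theorem hasDerivAt_logSineDeriv (h0 : 0 < σ) (hπ : σ < π) (m : ℕ) (ht : 0 ≤ t) :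
    HasDerivAt (logSineDeriv σ m) (-logSineDeriv σ (m + 1) t) t := by
  have hy := hasDerivAt_logSineSq σ t
  have hw := hasDerivAt_inv_one_sub_logSineSq_pow h0 hπ ht m
  have hP := (Polynomial.hasDerivAt_aeval (lehmerPair m).1 (logSineSq σ t)).comp t hy
  have hQ := (Polynomial.hasDerivAt_aeval (lehmerPair m).2 (logSineSq σ t)).comp t hy
  have key := (((((hasDerivAt_logSineAngle h0 hπ ht).sub_const σ).mul
    (hasDerivAt_tan_logSineAngle h0 hπ ht)).mul hQ).mul hw).add (((hy.const_mul 2).mul hP).mul hw)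
  refine key.congr_deriv ?_
  have hT := tan_logSineAngle_sq h0 hπ ht
  have hE : 2 * (1 - logSineSq σ t) * (2 * (1 - logSineSq σ t))⁻¹ = 1 :=
    mul_inv_cancel₀ (by linarith [logSineSq_lt_one h0 hπ ht])
  simp only [logSineDeriv, lehmerPair, map_add, map_mul, map_sub, map_one, Polynomial.aeval_X,
    map_ofNat, map_natCast, Function.comp_apply, Pi.mul_apply]
  generalize (2 * (1 - logSineSq σ t))⁻¹ = w at *
  generalize tan (logSineAngle σ t / 2) = T at *
  generalize Polynomial.aeval (logSineSq σ t) (lehmerPair m).1 = P at *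
  generalize Polynomial.aeval (logSineSq σ t) (lehmerPair m).2 = Q at *
  generalize Polynomial.aeval (logSineSq σ t) (Polynomial.derivative (lehmerPair m).1) = P' at *
  generalize Polynomial.aeval (logSineSq σ t) (Polynomial.derivative (lehmerPair m).2) = Q' at *
  -- `hT` turns `tan^2` into `2 y w`, feeding `q` into the recursion for `p`; `hE` raises terms in
  -- `w^m` to `w^(m+1)`, creating the factors `2 (1 - y)`.
  linear_combination (-Q * w ^ m) * hT + ((logSineAngle σ t - σ) * T * logSineSq σ t * Q' * w ^ m +
    2 * logSineSq σ t * P * w ^ m + 2 * logSineSq σ t ^ 2 * P' * w ^ m) * hE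

/-- For `t ≥ 0` the argument stays in the compact interval `[0, sin² (σ/2)]`, away from the pole at
1. -/
theorem exists_bound_aeval_mul_pow (h0 : 0 < σ) (hπ : σ < π) (P : Polynomial ℤ) (m : ℕ) :
    ∃ B, 0 ≤ B ∧ ∀ t, 0 ≤ t → |Polynomial.aeval (logSineSq σ t) P *
      ((2 * (1 - logSineSq σ t))⁻¹) ^ m| ≤ B := by
  have hcont : ContinuousOn (fun y : ℝ => Polynomial.aeval y P * ((2 * (1 - y))⁻¹) ^ m)
      (Icc 0 (sin (σ / 2) ^ 2)) := by
    refine (Polynomial.continuous_aeval P).continuousOn.mul (ContinuousOn.pow ?_ m)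
    refine ContinuousOn.inv₀ (by fun_prop) fun y hy => ?_
    have := sin_half_sq_lt_one h0 hπ
    have := hy.2
    linarith
  obtain ⟨B, hB⟩ := isCompact_Icc.exists_bound_of_continuousOn hcont
  refine ⟨B, ?_, fun t ht => hB _ ⟨logSineSq_nonneg σ t, logSineSq_le ht⟩⟩
  exact (norm_nonneg _).trans (hB 0 ⟨le_rfl, sq_nonneg _⟩)

theorem isDecayingDerivSeq_logSineDeriv (h0 : 0 < σ) (hπ : σ < π) :
    IsDecayingDerivSeq (1 / 2) (logSineDeriv σ) where
  pos := by norm_num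
  hasDerivAt m t ht := hasDerivAt_logSineDeriv h0 hπ m ht
  bound m := by
    obtain ⟨B, hB0, hB⟩ := exists_bound_aeval_mul_pow h0 hπ (lehmerPair m).2 m
    obtain ⟨A, hA0, hA⟩ := exists_bound_aeval_mul_pow h0 hπ (lehmerPair m).1 m
    set r := √(1 - sin (σ / 2) ^ 2)
    have hr : 0 < r := sqrt_pos.2 (by linarith [sin_half_sq_lt_one h0 hπ])
    refine ⟨(2 * π) * (1 / r) * B + 2 * A, fun t ht => ?_⟩
    have hs1 := sin_half_lt_one h0 hπ
    have hs0 := sin_half_pos h0 hπ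
    have hangle : |logSineAngle σ t - σ| ≤ 2 * π := by
      have h1 := neg_pi_div_two_le_arcsin (sin (σ / 2) * exp (-t / 2))
      have h2 := arcsin_le_pi_div_two (sin (σ / 2) * exp (-t / 2))
      rw [logSineAngle, abs_le]
      constructor <;> linarith
    have hexp : exp (-(1 / 2) * t) = exp (-t / 2) := by congr 1; ring
    have htan : |tan (logSineAngle σ t / 2)| ≤ 1 / r * exp (-t / 2) := by
      rw [abs_of_pos (tan_logSineAngle_pos h0 hπ ht), tan_logSineAngle, one_div_mul_eq_div]
      have : r ≤ √(1 - logSineSq σ t) := sqrt_le_sqrt (by linarith [logSineSq_le (σ := σ) ht])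
      gcongr
      exact mul_le_of_le_one_left (exp_pos _).le hs1.le
    have hsq : |logSineSq σ t| ≤ exp (-t / 2) := by
      rw [abs_of_nonneg (logSineSq_nonneg σ t), logSineSq]
      calc _ ≤ 1 * exp (-t) := by
            gcongr
            exact (sin_half_sq_lt_one h0 hπ).le
        _ ≤ _ := by rw [one_mul]; exact exp_le_exp.2 (by linarith)
    rw [logSineDeriv, hexp, mul_assoc (_ * tan _), mul_assoc (2 * logSineSq σ t)]
    refine (abs_add_le _ _).trans ?_
    rw [abs_mul ((logSineAngle σ t - σ) * _), abs_mul (logSineAngle σ t - σ),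
      abs_mul (2 * logSineSq σ t), abs_mul 2, abs_two]
    calc _ ≤ (2 * π) * (1 / r * exp (-t / 2)) * B + 2 * exp (-t / 2) * A := by
          gcongr
          · exact hB t ht
          · exact hA t ht
      _ = _ := by ring

theorem logSineAngle_zero (h0 : 0 < σ) (hπ : σ < π) : logSineAngle σ 0 = σ := by
  rw [logSineAngle, neg_zero, zero_div, exp_zero, mul_one, arcsin_sin (by linarith) (by linarith)]
  ring

theorem logSineDeriv_at_zero (h0 : 0 < σ) (hπ : σ < π) (m : ℕ) :
    logSineDeriv σ m 0 = 2 * sin (σ / 2) ^ 2 *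
      Polynomial.aeval (sin (σ / 2) ^ 2) (lehmerPair m).1 *
        ((2 * (1 - sin (σ / 2) ^ 2))⁻¹) ^ m := by
  rw [logSineDeriv, logSineAngle_zero h0 hπ]
  simp [logSineSq]

theorem sin_half_logSineAngle (h0 : 0 < σ) (hπ : σ < π) (ht : 0 ≤ t) :
    sin (logSineAngle σ t / 2) = sin (σ / 2) * exp (-t / 2) := by
  have h1 := sin_half_mul_exp_le h0 hπ ht
  have h2 := sin_half_mul_exp_pos h0 hπ t
  have h3 := sin_half_lt_one h0 hπ
  rw [logSineAngle, mul_div_cancel_left₀ _ two_ne_zero, sin_arcsin (by linarith) (by linarith)]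

theorem neg_two_log_logSineAngle (h0 : 0 < σ) (hπ : σ < π) (ht : 0 ≤ t) :
    -2 * log (sin (logSineAngle σ t / 2) / sin (σ / 2)) = t := by
  rw [sin_half_logSineAngle h0 hπ ht, mul_div_cancel_left₀ _ (sin_half_pos h0 hπ).ne', log_exp]
  ring

theorem logSineAngle_injOn (h0 : 0 < σ) (hπ : σ < π) : InjOn (logSineAngle σ) (Ioi 0) :=
  LeftInvOn.injOn (f₁' := fun θ => -2 * log (sin (θ / 2) / sin (σ / 2)))
    fun _ ht => neg_two_log_logSineAngle h0 hπ (le_of_lt ht)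

theorem logSineAngle_image (h0 : 0 < σ) (hπ : σ < π) :
    logSineAngle σ '' Ioi 0 = Ioo 0 σ := by
  have hs := sin_half_pos h0 hπ
  ext φ
  constructor
  · rintro ⟨t, ht, rfl⟩
    have h2 := sin_half_mul_exp_pos h0 hπ t
    have h1 : sin (σ / 2) * exp (-t / 2) < sin (σ / 2) :=
      mul_lt_of_lt_one_right hs (exp_lt_one_iff.2 (by linarith [mem_Ioi.1 ht]))
    have h3 := sin_half_lt_one h0 hπ
    refine ⟨mul_pos two_pos (arcsin_pos.2 h2), ?_⟩
    have : arcsin (sin (σ / 2) * exp (-t / 2)) < arcsin (sin (σ / 2)) :=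
      arcsin_lt_arcsin (by linarith) h1 h3.le
    rw [arcsin_sin (by linarith) (by linarith)] at this
    rw [logSineAngle]
    linarith
  · rintro ⟨h1, h2⟩
    have hφ : 0 < sin (φ / 2) := sin_half_pos h1 (h2.trans hπ)
    have hlt : sin (φ / 2) < sin (σ / 2) :=
      sin_lt_sin_of_lt_of_le_pi_div_two (by linarith) (by linarith) (by linarith)
    have hlog := log_neg (div_pos hφ hs) ((div_lt_one hs).2 hlt)
    refine ⟨-2 * log (sin (φ / 2) / sin (σ / 2)), mem_Ioi.2 (by linarith), ?_⟩
    rw [logSineAngle, show -(-2 * log (sin (φ / 2) / sin (σ / 2))) / 2 =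
      log (sin (φ / 2) / sin (σ / 2)) by ring, exp_log (div_pos hφ hs), mul_div_cancel₀ _ hs.ne',
      arcsin_sin (by linarith) (by linarith)]
    ring

theorem abs_deriv_smul_shiftedLogSineIntegrand (h0 : 0 < σ) (hπ : σ < π) (s : ℂ) (ht : 0 < t) :
    |-tan (logSineAngle σ t / 2)| • shiftedLogSineIntegrand s σ (logSineAngle σ t) =
      (t : ℂ) ^ (s - 1 - 1) • (logSineDeriv σ 0 t : ℂ) := by
  rw [abs_neg, abs_of_pos (tan_logSineAngle_pos h0 hπ ht.le), shiftedLogSineIntegrand,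
    neg_two_log_logSineAngle h0 hπ ht.le, show s - 1 - 1 = s - 2 by ring]
  simp [logSineDeriv, lehmerPair]
  ring

theorem intervalIntegrable_shiftedLogSineIntegrand (h0 : 0 < σ) (hπ : σ < π) {s : ℂ}
    (hs : 1 < s.re) : IntervalIntegrable (shiftedLogSineIntegrand s σ) volume 0 σ := by
  rw [intervalIntegrable_iff_integrableOn_Ioc_of_le h0.le, integrableOn_Ioc_iff_integrableOn_Ioo,
    ← logSineAngle_image h0 hπ, integrableOn_image_iff_integrableOn_abs_deriv_smul measurableSet_Ioi
      (fun t ht => (hasDerivAt_logSineAngle h0 hπ (le_of_lt ht)).hasDerivWithinAt)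
      (logSineAngle_injOn h0 hπ)]
  have := (isDecayingDerivSeq_logSineDeriv h0 hπ).mellinConvergent 0 (s := s - 1) (by simpa using hs)
  exact this.congr_fun
    (fun t ht => (abs_deriv_smul_shiftedLogSineIntegrand h0 hπ s ht).symm) measurableSet_Ioi

/-- Valid for every `s`, since the change of variables needs no integrability. -/
theorem shiftedLogSine_eq_mellin (h0 : 0 < σ) (hπ : σ < π) (s : ℂ) :
    shiftedLogSine s σ =
      (Complex.Gamma (s - 1))⁻¹ * mellin (fun t => (logSineDeriv σ 0 t : ℂ)) (s - 1) := by
  rw [shiftedLogSine, one_div, intervalIntegral.integral_of_le h0.le, integral_Ioc_eq_integral_Ioo,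
    ← logSineAngle_image h0 hπ, integral_image_eq_integral_abs_deriv_smul measurableSet_Ioi
      (fun t ht => (hasDerivAt_logSineAngle h0 hπ (le_of_lt ht)).hasDerivWithinAt)
      (logSineAngle_injOn h0 hπ), mellin]
  congr 1
  exact setIntegral_congr_fun measurableSet_Ioi
    fun t ht => abs_deriv_smul_shiftedLogSineIntegrand h0 hπ s ht

theorem isShiftedLogSineContinuation_entireMellin (h0 : 0 < σ) (hπ : σ < π) :
    IsShiftedLogSineContinuation σ
      fun s => IsDecayingDerivSeq.entireMellin (logSineDeriv σ) (s - 1) := by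
  have H := isDecayingDerivSeq_logSineDeriv h0 hπ
  refine ⟨H.differentiable_entireMellin.comp (differentiable_id.sub_const 1), fun s hs => ?_⟩
  exact (H.entireMellin_eq_mellin (by simpa using hs)).trans
    (shiftedLogSine_eq_mellin h0 hπ s).symm

theorem IsShiftedLogSineContinuation.unique {F G : ℂ → ℂ} (hF : IsShiftedLogSineContinuation σ F)
    (hG : IsShiftedLogSineContinuation σ G) : F = G := by
  refine AnalyticOnNhd.eq_of_eventuallyEq (z₀ := 2)
    (Complex.analyticOnNhd_univ_iff_differentiable.2 hF.1)
    (Complex.analyticOnNhd_univ_iff_differentiable.2 hG.1) ?_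
  have : ∀ᶠ z : ℂ in 𝓝 2, 1 < z.re :=
    Complex.continuous_re.continuousAt.eventually_const_lt (by norm_num)
  filter_upwards [this] with z hz
  rw [hF.2 z hz, hG.2 z hz]

theorem IsShiftedLogSineContinuation.apply_one_sub_natCast {F : ℂ → ℂ} (h0 : 0 < σ) (hπ : σ < π)
    (hF : IsShiftedLogSineContinuation σ F) (m : ℕ) : F (1 - m) = logSineDeriv σ m 0 := by
  have e : (1 : ℂ) - m - 1 = -m := by ring
  rw [hF.unique (isShiftedLogSineContinuation_entireMellin h0 hπ),
    ← (isDecayingDerivSeq_logSineDeriv h0 hπ).entireMellin_neg_natCast m, ← e]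

end

/-! ### The special value at π/3 -/

section

open Real Set Polynomial

/-- Umbrally, `-d/dt` is multiplication by `X`; on a product with `e^(-t)` it therefore acts as `X +
1`. -/
theorem hasDerivAt_momentFunctional_logSineDeriv {σ t : ℝ} (h0 : 0 < σ) (hπ : σ < π) (ht : 0 ≤ t)
    (p : ℝ[X]) :
    HasDerivAt (fun t => momentFunctional (fun m => logSineDeriv σ m t) p)
      (-momentFunctional (fun m => logSineDeriv σ m t) (p * X)) t := by
  induction p using Polynomial.induction_on' with
  | add p q hp hq =>
    simp only [add_mul, map_add]
    exact (hp.add hq).congr_deriv (by ring)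
  | monomial n a =>
    simp only [← C_mul_X_pow_eq_monomial, mul_assoc, ← pow_succ, momentFunctional_C_mul,
      momentFunctional_X_pow]
    exact ((hasDerivAt_logSineDeriv h0 hπ n ht).const_mul a).congr_deriv (by ring)

theorem sin_pi_div_three_half_sq : sin (π / 3 / 2) ^ 2 = 1 / 4 := by
  rw [show π / 3 / 2 = π / 6 by ring, sin_pi_div_six]
  norm_num

/-- The differential equation `(4 - e^(-t)) f' + 2 f + e^(-t) = 0` at `σ = π / 3`, differentiated
`n` times. -/
theorem logSineDeriv_pi_div_three_relation (n : ℕ) {t : ℝ} (ht : 0 ≤ t) :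
    4 * logSineDeriv (π / 3) (n + 1) t -
        exp (-t) * momentFunctional (fun m => logSineDeriv (π / 3) m t) ((X + 1) ^ n * X) =
      2 * logSineDeriv (π / 3) n t + exp (-t) := by
  have h0 : 0 < π / 3 := by positivity
  have hπ : π / 3 < π := by linarith [pi_pos]
  induction n generalizing t with
  | zero =>
    have hy : logSineSq (π / 3) t = exp (-t) / 4 := by
      rw [logSineSq, sin_pi_div_three_half_sq]; ring
    have hE : 2 * (1 - exp (-t) / 4) * (2 * (1 - exp (-t) / 4))⁻¹ = 1 := by
      rw [← hy]
      exact mul_inv_cancel₀ (by linarith [logSineSq_lt_one h0 hπ ht])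
    rw [pow_zero, one_mul, momentFunctional_X]
    simp only [logSineDeriv, lehmerPair, hy, zero_add, pow_one, pow_zero, mul_one, map_one, map_zero,
      mul_zero, derivative_one, add_zero, zero_mul, Nat.cast_zero]
    generalize (2 * (1 - exp (-t) / 4))⁻¹ = w at *
    linear_combination (2 * (logSineAngle (π / 3) t - π / 3) * tan (logSineAngle (π / 3) t / 2) +
      exp (-t)) * hE
  | succ n ih =>
    have hexp : HasDerivAt (fun t : ℝ => exp (-t)) (-exp (-t)) t :=
      ((hasDerivAt_id t).neg.exp).congr_deriv (by simp)
    have hl := ((hasDerivAt_logSineDeriv h0 hπ (n + 1) ht).const_mul 4).sub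
      (hexp.mul (hasDerivAt_momentFunctional_logSineDeriv h0 hπ ht ((X + 1) ^ n * X)))
    have hr := ((hasDerivAt_logSineDeriv h0 hπ n ht).const_mul 2).add hexp
    -- The relation is known only for `t ≥ 0`, so at `t = 0` the derivatives are compared within
    -- `[0, ∞)`.
    have key := (uniqueDiffOn_Ici (0 : ℝ) t ht).eq_deriv _ hl.hasDerivWithinAt
      (hr.hasDerivWithinAt.congr (fun u hu => ih hu) (ih ht))
    have e : (X + 1 : ℝ[X]) ^ (n + 1) * X = (X + 1) ^ n * X * X + (X + 1) ^ n * X := by ring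
    rw [e, map_add]
    linear_combination -key

theorem momentFunctional_logSineDeriv_pi_div_three (p : ℝ[X]) :
    momentFunctional (fun m => logSineDeriv (π / 3) m 0)
      ((C 4 * X - C 2) * p - X * p.comp (X + 1)) = p.eval 1 := by
  refine linearMap_ext_X_pow (f := (momentFunctional fun m => logSineDeriv (π / 3) m 0).comp
    (LinearMap.mulLeft ℝ (C 4 * X - C 2) - (LinearMap.mulLeft ℝ X).comp
      (aeval (X + 1 : ℝ[X])).toLinearMap)) (g := leval 1) (fun n => ?_) p
  have h := logSineDeriv_pi_div_three_relation n le_rfl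
  have e : (C 4 * X - C 2) * X ^ n - X * (X + 1) ^ n =
      C 4 * X ^ (n + 1) - C 2 * X ^ n - (X + 1 : ℝ[X]) ^ n * X := by ring
  simp only [LinearMap.comp_apply, LinearMap.sub_apply, LinearMap.mulLeft_apply,
    AlgHom.toLinearMap_apply, map_pow, aeval_X, leval_apply, eval_pow, eval_X, one_pow]
  rw [e, map_sub, map_sub, momentFunctional_C_mul, momentFunctional_C_mul, momentFunctional_X_pow,
    momentFunctional_X_pow]
  rw [neg_zero, exp_zero, one_mul] at h
  linear_combination h

theorem logSineDeriv_pi_div_three_succ (n : ℕ) :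
    logSineDeriv (π / 3) (n + 1) 0 =
      ((1 / 3 * ∑ k ∈ Finset.range (n + 1), polyBernoulli (-(k : ℤ)) (n - k) : ℚ) : ℝ) := by
  have h0 : 0 < π / 3 := by positivity
  have hπ : π / 3 < π := by linarith [pi_pos]
  have h := three_mul_eq_sum_stirlingFunctional
    (momentFunctional fun m => logSineDeriv (π / 3) m 0)
    (by rw [momentFunctional_one, logSineDeriv_at_zero h0 hπ]; simp [lehmerPair])
    momentFunctional_logSineDeriv_pi_div_three (n + 1) (n + 1) le_rfl
  simp only [momentFunctional_X_pow, stirlingFunctional_X_pow_succ] at h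
  rw [sum_stirlingConv] at h
  rw [Rat.cast_mul, ← h]
  push_cast
  ring

end

theorem theorem1p1 :
    (∀ σ : ℝ, 0 < σ → σ < Real.pi →
      (∀ s : ℂ, 1 < s.re →
        IntervalIntegrable (shiftedLogSineIntegrand s σ) MeasureTheory.volume 0 σ) ∧
      (∃! F : ℂ → ℂ, IsShiftedLogSineContinuation σ F) ∧
      (∀ F : ℂ → ℂ, IsShiftedLogSineContinuation σ F →
        ∀ n : ℤ, -1 ≤ n → ∀ x : ℝ, x = Real.sin (σ / 2) ^ 2 →
          F (-(n : ℂ)) =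
            ((x * Polynomial.aeval x (lehmerP n) / ((2 : ℝ) ^ n * (1 - x) ^ (n + 1)) : ℝ) : ℂ))) ∧
    (∀ F : ℂ → ℂ, IsShiftedLogSineContinuation (Real.pi / 3) F →
      ∀ n : ℕ, F (-(n : ℂ)) =
        ((1 / 3 * ∑ k ∈ Finset.range (n + 1), polyBernoulli (-(k : ℤ)) (n - k) : ℚ) : ℂ)) := by
  refine ⟨fun σ h0 hπ => ⟨fun s hs => intervalIntegrable_shiftedLogSineIntegrand h0 hπ hs,
    ⟨_, isShiftedLogSineContinuation_entireMellin h0 hπ,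
      fun G hG => hG.unique (isShiftedLogSineContinuation_entireMellin h0 hπ)⟩,
    fun F hF n hn x hx => ?_⟩, fun F hF n => ?_⟩
  -- With `n = m - 1`, the factor 2 in `logSineDeriv_at_zero` turns `2^m` into `2^n`; for `m = 0`
  -- this is `2^(-1)`.
  · obtain ⟨m, rfl⟩ : ∃ m : ℕ, n = m - 1 := ⟨(n + 1).toNat, by omega⟩
    have e : -(((m : ℤ) - 1 : ℤ) : ℂ) = 1 - m := by push_cast; ring
    rw [e, hF.apply_one_sub_natCast h0 hπ, logSineDeriv_at_zero h0 hπ, ← hx, lehmerP,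
      sub_add_cancel, Int.toNat_natCast, zpow_natCast, zpow_sub_one₀ two_ne_zero, zpow_natCast,
      inv_pow, mul_pow]
    have hx1 : 1 - x ≠ 0 := by
      have := sin_half_sq_lt_one h0 hπ
      linarith
    congr 1
    field_simp
  · have h0 : 0 < Real.pi / 3 := by positivity
    have hπ : Real.pi / 3 < Real.pi := by linarith [Real.pi_pos]
    have e : -(n : ℂ) = 1 - (n + 1 : ℕ) := by push_cast; ring
    rw [e, hF.apply_one_sub_natCast h0 hπ, logSineDeriv_pi_div_three_succ, Complex.ofReal_ratCast]
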